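/- For a positive integer $k$, Deaconescu's conjecture for $k$ is the assertion: if $G$ is a finite group in which at least half of the elements have order exactly $k$, that is, $|\{g\in G : o(g)=k\}|/|G| \ge 1/2$, then $G$ is soluble. (2) The conjecture fails for every integer $k>4$ that is divisible by $2$ or by $3$: for each such $k$ there is a finite non-soluble group in which at least half of the elements have order exactly $k$. (3) The conjecture also fails for some $k$ divisible neither by $2$ nor by $3$: there are a positive integer $k$ with $2\nmid k$ and $3\nmid k$ and a finite non-soluble group in which at least half of the elements have order exactly $k$. -/

import Mathlib

/-- The proportion, among the elements of a (finite) group `G`, of the elements whose order is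
exactly `k`. -/
noncomputable def exactOrderRatio (k : ℕ) (G : Type) [Group G] : ℚ :=
  (Nat.card {g : G // orderOf g = k} : ℚ) / (Nat.card G : ℚ)

/-- Deaconescu's conjecture for a fixed `k`: every finite group in which at least half of the
elements have order exactly `k` is soluble. Every finite group is isomorphic to one whose
underlying type lives in `Type`, so quantifying over `Type` covers all finite groups. -/
def DeaconescuConjecture (k : ℕ) : Prop :=
  ∀ (G : Type) [Group G] [Finite G], 1 / 2 ≤ exactOrderRatio k G → Group.IsSolvable G

/-! It is enough to find a non-soluble `Q` in which strictly more than half of the elements satisfy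
`x ^ k = 1`. In `Q × (ℤ/k)ⁿ` such an `x` paired with a vector of order `k` has order exactly `k`,
and almost all vectors have order `k` once `n` is large. The condition `x ^ k = 1` passes to
multiples of `k`, and `Q` may be presented as `G ⧸ Z` with `Z` soluble, so that one counts `g ^ b ∈
Z` in `G`.

The groups used are S₅ for `6 ∣ k`, PGL₂(7) for `8 ∣ k`, PSL₂(11) for `k = 55`, all by direct count,
and two infinite families: SL₂(2^p) ⋊ C_p for `2 * p ∣ k`, `p ≥ 5`, and (SL₂(3^p) ⋊ C_p)/{±1} for `3
* p ∣ k`, `p ≥ 3`. In the families, each coset of SL₂ over a nontrivial `τ` in C_p contains few but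
large classes of elements whose `p`-th power is unipotent up to sign. Their centralizers lie in SL₂
of the prime field, so these classes fill at least 2/3 of the coset in characteristic 2, and 3/4 in
characteristic 3. -/

/-! ### Reduction to counting solutions of `x ^ k = 1` -/

theorem exists_mul_pred_pow_le_pow (c : ℕ) {k : ℕ} (hk : 0 < k) :
    ∃ n : ℕ, c * (k - 1) ^ n ≤ k ^ n := by
  have hk' : (0 : ℝ) < k := by exact_mod_cast hk
  obtain ⟨n, hn⟩ := exists_pow_lt_of_lt_one (show (0 : ℝ) < 1 / (c + 1) by positivity)
    (show ((k - 1 : ℕ) : ℝ) / k < 1 by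
      rw [div_lt_one hk']; exact_mod_cast Nat.sub_lt hk one_pos)
  refine ⟨n, ?_⟩
  rw [div_pow, div_lt_div_iff₀ (by positivity) (by positivity), one_mul] at hn
  have : ((k - 1 : ℕ) : ℝ) ^ n * (c + 1) ≤ (k : ℝ) ^ n := hn.le
  have h2 : (k - 1) ^ n * (c + 1) ≤ k ^ n := by exact_mod_cast this
  nlinarith [Nat.zero_le ((k - 1) ^ n)]

/-- All but `(k - 1) ^ n` elements of `(ℤ/k)ⁿ` have a coordinate equal to `1`. -/
theorem card_exists_coord_eq_ofAdd_one {k : ℕ} (hk : 0 < k) (n : ℕ) :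
    Nat.card {v : Fin n → Multiplicative (ZMod k) // ∃ i, v i = Multiplicative.ofAdd 1}
      + (k - 1) ^ n = k ^ n := by
  have : NeZero k := ⟨hk.ne'⟩
  classical
  have hc : Nat.card {v : Fin n → Multiplicative (ZMod k) //
      ¬ ∃ i, v i = Multiplicative.ofAdd 1} = (k - 1) ^ n := by
    have e : {v : Fin n → Multiplicative (ZMod k) // ¬ ∃ i, v i = Multiplicative.ofAdd 1} ≃
        (Fin n → {x : Multiplicative (ZMod k) // x ≠ Multiplicative.ofAdd 1}) :=
      (Equiv.subtypeEquivRight fun v => by simp).trans Equiv.subtypePiEquivPi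
    rw [Nat.card_congr e, Nat.card_fun, Nat.card_eq_fintype_card, Fintype.card_subtype_compl]
    simp [ZMod.card]
  rw [← hc, Nat.card_eq_fintype_card, Nat.card_eq_fintype_card, Fintype.card_subtype_compl,
    Nat.add_sub_cancel' (Fintype.card_subtype_le _)]
  simp [ZMod.card]

theorem not_deaconescuConjecture_of_card_lt {Q : Type} [Group Q] [Finite Q]
    (hQ : ¬ Group.IsSolvable Q) {k : ℕ} (hk : 0 < k)
    (h : Nat.card Q < 2 * Nat.card {x : Q // x ^ k = 1}) : ¬ DeaconescuConjecture k := by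
  intro hD
  have : NeZero k := ⟨hk.ne'⟩
  -- The factor `Nat.card Q + 1` fits `2 * m ≥ Nat.card Q + 1`: the discarded vectors cost at most
  -- the surplus `k ^ n`.
  obtain ⟨n, hn⟩ := exists_mul_pred_pow_le_pow (Nat.card Q + 1) hk
  have hv := card_exists_coord_eq_ofAdd_one hk n
  set s := Nat.card {v : Fin n → Multiplicative (ZMod k) // ∃ i, v i = Multiplicative.ofAdd 1}
  set m := Nat.card {x : Q // x ^ k = 1}
  refine hQ ?_
  have hcard : Nat.card (Q × (Fin n → Multiplicative (ZMod k))) = Nat.card Q * k ^ n := by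
    simp [Nat.card_prod]
  have hle : m * s ≤ Nat.card {g : Q × (Fin n → Multiplicative (ZMod k)) // orderOf g = k} := by
    rw [← Nat.card_prod]
    refine Nat.card_le_card_of_injective (fun a => ⟨(a.1.1, a.2.1), ?_⟩) ?_
    · obtain ⟨⟨x, hx⟩, v, i, hi⟩ := a
      refine Nat.dvd_antisymm (orderOf_dvd_of_pow_eq_one ?_) ?_
      · refine Prod.ext hx (funext fun j => ?_)
        show (v j) ^ k = 1
        have := pow_card_eq_one (x := v j)
        simpa [ZMod.card] using this
      · have h1 : orderOf (Multiplicative.ofAdd (1 : ZMod k)) = k := by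
          rw [orderOf_ofAdd_eq_addOrderOf, ZMod.addOrderOf_one]
        have h2 := orderOf_map_dvd ((Pi.evalMonoidHom (fun _ : Fin n => Multiplicative (ZMod k)) i).comp
          (MonoidHom.snd Q _)) (x, v)
        have h3 : orderOf (v i) = k := by rw [hi, h1]
        exact h3.symm.dvd.trans h2
    · rintro ⟨⟨x, hx⟩, v, hv⟩ ⟨⟨y, hy⟩, w, hw⟩ hxy
      simp only [Subtype.mk.injEq, Prod.mk.injEq] at hxy ⊢
      exact hxy
  have key := hD (Q × (Fin n → Multiplicative (ZMod k))) ?_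
  · exact Group.isSolvable_of_surjective (f := MonoidHom.fst Q (Fin n → Multiplicative (ZMod k)))
      Prod.fst_surjective
  · have hpos : 0 < Nat.card Q := Nat.card_pos
    rw [exactOrderRatio, hcard, div_le_div_iff₀ two_pos (by positivity)]
    have h3 : Nat.card Q * k ^ n ≤ 2 * (m * s) := by
      have h4 : (Nat.card Q + 1) * s ≤ 2 * m * s := Nat.mul_le_mul_right _ h
      rw [← hv] at hn ⊢
      nlinarith
    have h5 := h3.trans (Nat.mul_le_mul_left 2 hle)
    rw [one_mul, mul_comm _ (2 : ℚ)]
    exact_mod_cast h5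

/-- If more than half of the elements of a non-soluble group have `b`-th power in a soluble normal
subgroup, Deaconescu's conjecture fails for all multiples of `b`. -/
theorem not_deaconescuConjecture_of_card_pow_mem {G : Type} [Group G] [Finite G]
    (hG : ¬ Group.IsSolvable G) (Z : Subgroup G) [Z.Normal] [Group.IsSolvable Z] {b k : ℕ}
    (hk : 0 < k) (hbk : b ∣ k) (h : Nat.card G < 2 * Nat.card {g : G // g ^ b ∈ Z}) :
    ¬ DeaconescuConjecture k := by
  refine not_deaconescuConjecture_of_card_lt (Q := G ⧸ Z) (fun hs => hG ?_) hk ?_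
  · exact Group.isSolvable_of_ker_le_range Z.subtype (QuotientGroup.mk' Z) (by simp)
  · have e : {g : G // g ^ b ∈ Z} ≃ Z × {x : G ⧸ Z // x ^ b = 1} :=
      (Equiv.subtypeEquivRight fun g => by
        show _ ↔ g ∈ QuotientGroup.mk ⁻¹' {x : G ⧸ Z | x ^ b = 1}
        simp [← QuotientGroup.mk_pow, QuotientGroup.eq_one_iff]).trans
      (QuotientGroup.preimageMkEquivSubgroupProdSet Z {x : G ⧸ Z | x ^ b = 1})
    rw [Nat.card_congr e, Nat.card_prod, Subgroup.card_eq_card_quotient_mul_card_subgroup Z] at h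
    have hle : Nat.card {x : G ⧸ Z // x ^ b = 1} ≤ Nat.card {x : G ⧸ Z // x ^ k = 1} := by
      refine Nat.card_le_card_of_injective (fun x => ⟨x.1, ?_⟩) fun x y hxy => ?_
      · obtain ⟨c, rfl⟩ := hbk
        rw [pow_mul, x.2, one_pow]
      · exact Subtype.ext (Subtype.mk.inj hxy)
    have hZ : 0 < Nat.card Z := Nat.card_pos
    refine lt_of_lt_of_le ?_ (Nat.mul_le_mul_left 2 hle)
    refine lt_of_mul_lt_mul_right (a := Nat.card Z) ?_ (Nat.zero_le _)
    linarith

theorem Matrix.SpecialLinearGroup.not_isSolvable_fin_two {F : Type*} [Field F] {a : F} (ha : a ≠ 0)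
    (ha2 : a ^ 2 ≠ 1) : ¬ Group.IsSolvable (Matrix.SpecialLinearGroup (Fin 2) F) := by
  have : Nontrivial (Matrix.SpecialLinearGroup (Fin 2) F) :=
    ⟨⟨!![1, 1; 0, 1], by simp⟩, 1, fun h => by
      have := congrArg (fun g : Matrix.SpecialLinearGroup (Fin 2) F => g 0 1) h
      simp at this⟩
  have : Group.IsPerfect (Matrix.SpecialLinearGroup (Fin 2) F) :=
    ⟨SL2.commutator_eq_top ha ha2⟩
  exact Group.IsPerfect.not_isSolvable _

/-! ### SL₂(11) and `k = 55` -/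

namespace Matrix.SpecialLinearGroup

theorem pow_two_coe_fin_two {R : Type*} [CommRing R] (g : SpecialLinearGroup (Fin 2) R) :
    (g : Matrix (Fin 2) (Fin 2) R) ^ 2 = (g 0 0 + g 1 1) • (g : Matrix (Fin 2) (Fin 2) R) - 1 := by
  have h := g.2
  rw [det_fin_two] at h
  ext i j
  fin_cases i <;> fin_cases j <;> simp [pow_two, mul_apply, Fin.sum_univ_two]
  · linear_combination -h
  · ring
  · ring
  · linear_combination -h

open Polynomial in
-- By Cayley–Hamilton `g` is a root of the quadratic on the left.
theorem pow_eq_one_of_dvd {R : Type*} [CommRing R] (g : SpecialLinearGroup (Fin 2) R) {n : ℕ}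
    (h : X ^ 2 - C (g 0 0 + g 1 1) * X + 1 ∣ (X ^ n - 1 : R[X])) : g ^ n = 1 := by
  obtain ⟨q, hq⟩ := h
  have h0 := congrArg (aeval (g : Matrix (Fin 2) (Fin 2) R)) hq
  have h1 : (g : Matrix (Fin 2) (Fin 2) R) ^ 2 - (g 0 0 + g 1 1) • (g : Matrix (Fin 2) (Fin 2) R) + 1
      = 0 := by
    rw [pow_two_coe_fin_two]; abel
  rw [map_mul, map_add, map_sub, map_sub, map_mul, aeval_C, ← Algebra.smul_def] at h0
  simp only [map_pow, map_one, aeval_X] at h0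
  rw [h1, zero_mul] at h0
  exact Subtype.ext (sub_eq_zero.1 h0)

/-- A matrix in `SL₂(R)` is a quadruple `(a, b), (c, d)` with `a d - b c = 1`. -/
def equivQuadruple (R : Type*) [CommRing R] : SpecialLinearGroup (Fin 2) R ≃
    {x : (R × R) × (R × R) // x.1.1 * x.2.2 - x.1.2 * x.2.1 = 1} where
  toFun g := ⟨((g 0 0, g 0 1), (g 1 0, g 1 1)), by
    have h := g.2
    rwa [det_fin_two] at h⟩
  invFun x := ⟨!![x.1.1.1, x.1.1.2; x.1.2.1, x.1.2.2], by rw [det_fin_two_of]; exact x.2⟩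
  left_inv g := by ext i j; fin_cases i <;> fin_cases j <;> rfl
  right_inv x := rfl

theorem card_zmod_eleven : Nat.card (SpecialLinearGroup (Fin 2) (ZMod 11)) = 1320 := by
  rw [Nat.card_congr (equivQuadruple _), Nat.card_eq_fintype_card]
  decide +kernel

open Polynomial in
-- Trace 2 means unipotent; traces 3 and 7 are the sums `ζ + ζ⁻¹` for the primitive fifth roots of
-- unity `ζ` in 𝔽₁₁. In characteristic 11, `X ^ 55 - 1` is the 11th power of `X ^ 5 - 1`.
theorem pow_fiftyFive_eq_one (g : SpecialLinearGroup (Fin 2) (ZMod 11))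
    (h : g 0 0 + g 1 1 = 2 ∨ g 0 0 + g 1 1 = 3 ∨ g 0 0 + g 1 1 = 7) : g ^ 55 = 1 := by
  have hp : Fact (Nat.Prime 11) := ⟨by norm_num⟩
  have h11 : (11 : (ZMod 11)[X]) = 0 := CharP.ofNat_eq_zero _ 11
  have h5 : (X ^ 5 - 1 : (ZMod 11)[X]) =
      (X - 1) * (X ^ 2 - C 3 * X + 1) * (X ^ 2 - C 7 * X + 1) := by
    simp only [map_ofNat]
    linear_combination (X ^ 4 - 3 * X ^ 3 + 3 * X ^ 2 - X) * h11
  have h55 : (X ^ 55 - 1 : (ZMod 11)[X]) = (X ^ 5 - 1) ^ 11 := by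
    rw [sub_pow_char]; ring
  have hle (f : (ZMod 11)[X]) (hf : f ∣ X ^ 5 - 1) : f ∣ X ^ 55 - 1 := by
    rw [h55]; exact dvd_pow hf (by norm_num)
  apply pow_eq_one_of_dvd
  rcases h with h | h | h <;> rw [h]
  · have h2 : (X ^ 2 - C 2 * X + 1 : (ZMod 11)[X]) = (X - 1) ^ 2 := by
      simp only [map_ofNat]; ring
    rw [h2, h55]
    refine (pow_dvd_pow_of_dvd ?_ 2).trans (pow_dvd_pow _ (by norm_num))
    rw [h5, mul_assoc]
    exact dvd_mul_right _ _
  · apply hle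
    rw [h5]
    exact (dvd_mul_left _ _).mul_right _
  · apply hle
    rw [h5]
    exact dvd_mul_left _ _

theorem lt_card_pow_fiftyFive : 660 < Nat.card
    {g : SpecialLinearGroup (Fin 2) (ZMod 11) // g ^ 55 ∈ Subgroup.zpowers (-1)} := by
  have h : 660 < Nat.card {x : {x : (ZMod 11 × ZMod 11) × (ZMod 11 × ZMod 11) //
      x.1.1 * x.2.2 - x.1.2 * x.2.1 = 1} //
      -- The negated traces come from `-g`, which has the same image modulo ±1.
      x.1.1.1 + x.1.2.2 ∈ ({2, 3, 7, -2, -3, -7} : Finset (ZMod 11))} := by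
    rw [Nat.card_eq_fintype_card]
    decide +kernel
  refine h.trans_le (Nat.card_le_card_of_injective (fun x => ⟨(equivQuadruple _).symm x.1, ?_⟩) ?_)
  · obtain ⟨x, hx⟩ := x
    set g := (equivQuadruple (ZMod 11)).symm x
    have hx' : g 0 0 + g 1 1 ∈ ({2, 3, 7, -2, -3, -7} : Finset (ZMod 11)) := hx
    simp only [Finset.mem_insert, Finset.mem_singleton] at hx'
    by_cases h1 : g 0 0 + g 1 1 = 2 ∨ g 0 0 + g 1 1 = 3 ∨ g 0 0 + g 1 1 = 7
    · rw [pow_fiftyFive_eq_one g h1]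
      exact one_mem _
    · have h2 : (-g) ^ 55 = 1 := by
        apply pow_fiftyFive_eq_one
        simp only [coe_neg, neg_apply, ← neg_add, neg_eq_iff_eq_neg]
        tauto
      rw [Odd.neg_pow (by decide), neg_eq_iff_eq_neg] at h2
      rw [h2]
      exact Subgroup.mem_zpowers _
  · intro x y hxy
    exact Subtype.ext ((equivQuadruple _).symm.injective (Subtype.mk.inj hxy))

end Matrix.SpecialLinearGroup

theorem Subgroup.normal_zpowers_of_mem_center {G : Type*} [Group G] {z : G}
    (hz : z ∈ Subgroup.center G) : (Subgroup.zpowers z).Normal :=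
  ⟨fun n hn g => by
    rwa [Subgroup.mem_center_iff.1 (Subgroup.zpowers_le.2 hz hn) g, mul_inv_cancel_right]⟩

theorem not_deaconescuConjecture_fiftyFive : ¬ DeaconescuConjecture 55 := by
  have h2 : (2 : ZMod 11) ≠ 0 := by decide
  have h4 : (2 : ZMod 11) ^ 2 ≠ 1 := by decide
  have hp : Fact (Nat.Prime 11) := ⟨by norm_num⟩
  have hZ := Subgroup.normal_zpowers_of_mem_center
    (z := (-1 : Matrix.SpecialLinearGroup (Fin 2) (ZMod 11)))
    (Subgroup.mem_center_iff.2 fun g => by simp)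
  refine not_deaconescuConjecture_of_card_pow_mem
    (Matrix.SpecialLinearGroup.not_isSolvable_fin_two (F := ZMod 11) (a := 2) h2 h4)
    (Subgroup.zpowers (-1)) (by norm_num) dvd_rfl ?_
  have := Matrix.SpecialLinearGroup.lt_card_pow_fiftyFive
  rw [Matrix.SpecialLinearGroup.card_zmod_eleven]
  omega

/-! ### S₅ and multiples of 6 -/

theorem not_deaconescuConjecture_of_six_dvd {k : ℕ} (hk : 0 < k) (h : 6 ∣ k) :
    ¬ DeaconescuConjecture k := by
  refine not_deaconescuConjecture_of_card_pow_mem Equiv.Perm.not_isSolvable_fin_5 ⊥ hk h ?_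
  have h1 : 60 < Nat.card {g : Equiv.Perm (Fin 5) // g ^ 6 ∈ (⊥ : Subgroup _)} := by
    simp only [Subgroup.mem_bot]
    rw [Nat.card_eq_fintype_card]
    decide +kernel
  have h2 : Nat.card (Equiv.Perm (Fin 5)) = 120 := by
    rw [Nat.card_perm, Nat.card_fin]
    rfl
  omega

/-! ### PGL₂(7) and multiples of 8 -/

namespace Matrix

/-- Cayley–Hamilton writes `A ^ 8` as a combination of `A` and `1`; the hypothesis kills the
coefficient of `A`. -/
theorem pow_eight_eq_smul_one {R : Type*} [CommRing R] (A : Matrix (Fin 2) (Fin 2) R)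
    (h : A.trace * (A.trace ^ 2 - 2 * A.det) *
      (A.trace ^ 4 - 4 * A.trace ^ 2 * A.det + 2 * A.det ^ 2) = 0) : ∃ s : R, A ^ 8 = s • 1 := by
  refine ⟨(A ^ 8) 0 0, ?_⟩
  rw [trace_fin_two, det_fin_two] at h
  have h8 : A ^ 8 = A * A * (A * A) * (A * A * (A * A)) := by noncomm_ring
  rw [h8]
  ext i j
  fin_cases i <;> fin_cases j <;> simp [mul_apply, Fin.sum_univ_two]
  · linear_combination A 0 1 * h
  · linear_combination A 1 0 * h
  · linear_combination (A 1 1 - A 0 0) * h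

theorem lt_card_pow_eight : 1008 < Nat.card
    {g : GL (Fin 2) (ZMod 7) // g ^ 8 ∈ Subgroup.center (GL (Fin 2) (ZMod 7))} := by
  have h : 1008 < Nat.card {x : (ZMod 7 × ZMod 7) × (ZMod 7 × ZMod 7) //
      x.1.1 * x.2.2 - x.1.2 * x.2.1 ≠ 0 ∧
      (x.1.1 + x.2.2) * ((x.1.1 + x.2.2) ^ 2 - 2 * (x.1.1 * x.2.2 - x.1.2 * x.2.1)) *
        ((x.1.1 + x.2.2) ^ 4 - 4 * (x.1.1 + x.2.2) ^ 2 * (x.1.1 * x.2.2 - x.1.2 * x.2.1) +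
          2 * (x.1.1 * x.2.2 - x.1.2 * x.2.1) ^ 2) = 0} := by
    rw [Nat.card_eq_fintype_card]
    decide +kernel
  have hp : Fact (Nat.Prime 7) := ⟨by norm_num⟩
  refine h.trans_le (Nat.card_le_card_of_injective (fun x => ⟨GeneralLinearGroup.mkOfDetNeZero
    !![x.1.1.1, x.1.1.2; x.1.2.1, x.1.2.2] (by rw [det_fin_two_of]; exact x.2.1), ?_⟩) ?_)
  · obtain ⟨s, hs⟩ := pow_eight_eq_smul_one !![x.1.1.1, x.1.1.2; x.1.2.1, x.1.2.2] (by
      rw [det_fin_two_of, trace_fin_two_of]; exact x.2.2)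
    refine Subgroup.mem_center_iff.2 fun g => Units.ext ?_
    simp only [Units.val_mul, Units.val_pow_eq_pow_val]
    show _ * !![x.1.1.1, x.1.1.2; x.1.2.1, x.1.2.2] ^ 8 = !![x.1.1.1, x.1.1.2; x.1.2.1, x.1.2.2] ^ 8 * _
    rw [hs]
    simp
  · rintro ⟨⟨⟨a, b⟩, c, d⟩, hx⟩ ⟨⟨⟨a', b'⟩, c', d'⟩, hy⟩ hxy
    have h0 : !![a, b; c, d] = !![a', b'; c', d'] := congrArg Units.val (Subtype.mk.inj hxy)
    have h1 := congrFun (congrFun h0 0) 0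
    have h2 := congrFun (congrFun h0 0) 1
    have h3 := congrFun (congrFun h0 1) 0
    have h4 := congrFun (congrFun h0 1) 1
    simp at h1 h2 h3 h4
    subst h1 h2 h3 h4
    rfl

end Matrix

theorem not_deaconescuConjecture_of_eight_dvd {k : ℕ} (hk : 0 < k) (h : 8 ∣ k) :
    ¬ DeaconescuConjecture k := by
  have h2 : (2 : ZMod 7) ≠ 0 := by decide
  have h4 : (2 : ZMod 7) ^ 2 ≠ 1 := by decide
  have hp : Fact (Nat.Prime 7) := ⟨by norm_num⟩
  have hZ : Group.IsSolvable (Subgroup.center (GL (Fin 2) (ZMod 7))) :=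
    Group.isSolvable_of_comm fun a b => Subtype.ext (Subgroup.mem_center_iff.1 b.2 a)
  refine not_deaconescuConjecture_of_card_pow_mem (G := GL (Fin 2) (ZMod 7)) (fun hs => ?_)
    (Subgroup.center _) hk h ?_
  · exact Matrix.SpecialLinearGroup.not_isSolvable_fin_two (F := ZMod 7) (a := 2) h2 h4 (Group.isSolvable_of_isSolvable_injective
        (f := Matrix.SpecialLinearGroup.toGL) Matrix.SpecialLinearGroup.toGL_injective)
  · have h1 := Matrix.lt_card_pow_eight
    have h2 : Nat.card (GL (Fin 2) (ZMod 7)) = 2016 := by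
      rw [Matrix.card_GL_field]
      simp [Fin.prod_univ_two, ZMod.card]
    omega

/-! ### Conjugacy classes in SL₂(K) ⋊ Gal(K/F) -/

/-- Orbit–stabilizer: the fibres of the conjugation map are cosets of the centralizer. -/
theorem Nat.card_le_mul_card_range_conj {G H : Type*} [Group G] [Finite G] [Group H] (f : G →* H)
    (a : H) {c : ℕ} (hc : Nat.card {g : G // f g * a = a * f g} ≤ c) :
    Nat.card G ≤ c * (Set.range fun g => f g * a * (f g)⁻¹).ncard := by
  classical
  have := Fintype.ofFinite G
  have h : (Set.range fun g => f g * a * (f g)⁻¹) =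
      (Finset.univ.image fun g => f g * a * (f g)⁻¹ : Finset H) := by simp
  rw [h, Set.ncard_coe_finset, Nat.card_eq_fintype_card, ← Finset.card_univ]
  refine Finset.card_le_mul_card_image _ _ fun b hb => ?_
  obtain ⟨g₀, -, rfl⟩ := Finset.mem_image.1 hb
  refine le_trans ?_ hc
  rw [Nat.card_eq_fintype_card, Fintype.card_subtype]
  refine Finset.card_le_card_of_injOn (fun g => g₀⁻¹ * g) (fun g hg => ?_) (by simp)
  have hg' : f g * a * (f g)⁻¹ = f g₀ * a * (f g₀)⁻¹ := by simpa using hg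
  rw [mul_inv_eq_iff_eq_mul] at hg'
  simp [mul_assoc, hg']

namespace Matrix.SpecialLinearGroup

variable {F K : Type*} [Field F] [Field K] [Algebra F K]

/-- The entrywise action of the Galois group on `SL₂`. -/
def galAction (F K : Type*) [Field F] [Field K] [Algebra F K] :
    (K ≃ₐ[F] K) →* MulAut (SpecialLinearGroup (Fin 2) K) where
  toFun τ :=
    { toFun := map (τ : K →+* K)
      invFun := map (τ.symm : K →+* K)
      left_inv g := by ext i j; simp
      right_inv g := by ext i j; simp
      map_mul' := map_mul _ }
  map_one' := by ext g i j; rfl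
  map_mul' σ τ := by ext g i j; rfl

@[simp]
theorem galAction_apply (τ : K ≃ₐ[F] K) (g : SpecialLinearGroup (Fin 2) K) (i j : Fin 2) :
    galAction F K τ g i j = τ (g i j) := rfl

/-- The upper unitriangular matrix with the entry `x`. -/
def unipotent {R : Type*} [CommRing R] (x : R) : SpecialLinearGroup (Fin 2) R :=
  ⟨!![1, x; 0, 1], by simp⟩

section unipotent

variable {R : Type*} [CommRing R]

theorem coe_unipotent (x : R) : (unipotent x : Matrix (Fin 2) (Fin 2) R) = !![1, x; 0, 1] := rfl

@[simp]
theorem unipotent_zero : unipotent (0 : R) = 1 := by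
  ext i j; fin_cases i <;> fin_cases j <;> simp [coe_unipotent]

theorem unipotent_mul (x y : R) : unipotent x * unipotent y = unipotent (x + y) := by
  ext i j; fin_cases i <;> fin_cases j <;> simp [coe_unipotent, mul_apply, add_comm]

theorem unipotent_pow (x : R) (n : ℕ) : unipotent x ^ n = unipotent (n * x) := by
  induction n with
  | zero => simp
  | succ n ih => rw [pow_succ, ih, unipotent_mul]; push_cast; ring_nf

theorem mul_unipotent_eq_iff {g : SpecialLinearGroup (Fin 2) R} {x y : R} {h : SpecialLinearGroup (Fin 2) R} :
    g * unipotent x = unipotent y * h ↔ g 0 0 = h 0 0 + y * h 1 0 ∧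
      g 0 0 * x + g 0 1 = h 0 1 + y * h 1 1 ∧ g 1 0 = h 1 0 ∧ g 1 0 * x + g 1 1 = h 1 1 := by
  rw [ext_iff]
  simp [Fin.forall_fin_two, coe_unipotent, mul_apply, and_assoc]

end unipotent

theorem galAction_unipotent (τ : K ≃ₐ[F] K) (x : K) :
    galAction F K τ (unipotent x) = unipotent (τ x) := by
  ext i j; fin_cases i <;> fin_cases j <;> simp [coe_unipotent]

/-- The semidirect product of `SL₂(K)` and the Galois group of `K/F`. -/
abbrev WithGal (F K : Type*) [Field F] [Field K] [Algebra F K] :=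
  SpecialLinearGroup (Fin 2) K ⋊[galAction F K] (K ≃ₐ[F] K)

open SemidirectProduct

theorem unipotent_mul_inr_pow (τ : K ≃ₐ[F] K) (x : K) (n : ℕ) :
    (inl (unipotent x) * inr τ : WithGal F K) ^ n =
      inl (unipotent (∑ i ∈ Finset.range n, (τ ^ i) x)) * inr (τ ^ n) := by
  induction n with
  | zero => simp
  | succ n ih =>
    rw [pow_succ, ih, Finset.sum_range_succ]
    ext1
    · simp only [mul_left, left_inl, left_inr, right_inr, right_inl, mul_right, map_one, mul_one,
        one_mul, galAction_unipotent, unipotent_mul]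
    · simp [pow_succ]

theorem mem_range_algebraMap_of_fixed [FiniteDimensional F K] [IsGalois F K] {τ : K ≃ₐ[F] K}
    (hτ : ∀ σ, σ ∈ Subgroup.zpowers τ) {x : K} (hx : τ x = x) : x ∈ Set.range (algebraMap F K) := by
  rw [IsGalois.mem_range_algebraMap_iff_fixed]
  intro σ
  have h : Subgroup.zpowers τ ≤ MulAction.stabilizer (K ≃ₐ[F] K) x :=
    Subgroup.zpowers_le.2 hx
  exact h (hτ σ)

theorem exists_map_eq_of_galAction_eq [FiniteDimensional F K] [IsGalois F K] {τ : K ≃ₐ[F] K}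
    (hτ : ∀ σ, σ ∈ Subgroup.zpowers τ) {g : SpecialLinearGroup (Fin 2) K}
    (hg : galAction F K τ g = g) :
    ∃ h : SpecialLinearGroup (Fin 2) F, map (algebraMap F K) h = g := by
  have h (i j : Fin 2) : ∃ y, algebraMap F K y = g i j := by
    refine mem_range_algebraMap_of_fixed hτ ?_
    rw [← galAction_apply, hg]
  choose y hy using h
  refine ⟨⟨Matrix.of y, ?_⟩, ?_⟩
  · apply (algebraMap F K).injective
    rw [RingHom.map_det, map_one]
    rw [← g.2]
    congr 1
    ext i j
    simp [hy]
  · ext i j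
    exact hy i j

theorem sum_range_pow_eq_trace [FiniteDimensional F K] [IsGalois F K] {τ : K ≃ₐ[F] K}
    (hτ : ∀ σ, σ ∈ Subgroup.zpowers τ) (x : K) :
    ∑ i ∈ Finset.range (Nat.card (K ≃ₐ[F] K)), (τ ^ i) x = algebraMap F K (Algebra.trace F K x) := by
  rw [trace_eq_sum_automorphisms]
  classical
  rw [← IsCyclic.image_range_card hτ, Finset.sum_image]
  intro i hi j hj hij
  rw [← orderOf_eq_card_of_forall_mem_zpowers hτ] at hi hj
  simp only [Finset.coe_range, Set.mem_Iio] at hi hj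
  exact pow_injOn_Iio_orderOf hi hj hij

/-- The `τ`-twisted product of unipotents adds up the Galois conjugates of `x`, that is, gives its
trace. -/
theorem unipotent_mul_inr_pow_card [FiniteDimensional F K] [IsGalois F K] {τ : K ≃ₐ[F] K}
    (hτ : ∀ σ, σ ∈ Subgroup.zpowers τ) (x : K) :
    (inl (unipotent x) * inr τ : WithGal F K) ^ Nat.card (K ≃ₐ[F] K) =
      inl (unipotent (algebraMap F K (Algebra.trace F K x))) := by
  rw [unipotent_mul_inr_pow, sum_range_pow_eq_trace hτ, pow_card_eq_one', map_one, mul_one]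

/-- The `SL₂(K)`-conjugates of an element of `SL₂(K) ⋊ Gal(K/F)`. -/
def conjugates (a : WithGal F K) : Set (WithGal F K) :=
  Set.range fun g : SpecialLinearGroup (Fin 2) K => inl g * a * (inl g)⁻¹

theorem right_eq_of_mem_conjugates {a b : WithGal F K} (h : b ∈ conjugates a) :
    b.right = a.right := by
  obtain ⟨g, rfl⟩ := h
  simp

theorem card_le_mul_ncard_conjugates_inr [Finite F] [Finite K] [IsGalois F K] {τ : K ≃ₐ[F] K}
    (hτ : ∀ σ, σ ∈ Subgroup.zpowers τ) :
    Nat.card (SpecialLinearGroup (Fin 2) K) ≤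
      Nat.card (SpecialLinearGroup (Fin 2) F) * (conjugates (inr τ : WithGal F K)).ncard := by
  refine Nat.card_le_mul_card_range_conj _ _ ?_
  have h (g : {g : SpecialLinearGroup (Fin 2) K // (inl g * inr τ : WithGal F K) = inr τ * inl g}) :
      ∃ h : SpecialLinearGroup (Fin 2) F, map (algebraMap F K) h = g.1 := by
    refine exists_map_eq_of_galAction_eq hτ ?_
    have := congrArg SemidirectProduct.left g.2
    simpa using this.symm
  choose f hf using h
  exact Nat.card_le_card_of_injective f fun g h hgh => Subtype.ext (by rw [← hf, ← hf, hgh])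

/-- Whatever centralizes the element also centralizes its power `unipotent (Tr x)`, so is upper
triangular with equal diagonal entries. It then commutes with `unipotent x`, hence is fixed by `τ`
and defined over `F`. -/
theorem card_le_mul_ncard_conjugates_unipotent [Finite F] [Finite K] [IsGalois F K]
    {τ : K ≃ₐ[F] K} (hτ : ∀ σ, σ ∈ Subgroup.zpowers τ) {x : K} (hx : Algebra.trace F K x ≠ 0) :
    Nat.card (SpecialLinearGroup (Fin 2) K) ≤
      Nat.card {g : SpecialLinearGroup (Fin 2) F // g 1 0 = 0} *
        (conjugates (inl (unipotent x) * inr τ : WithGal F K)).ncard := by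
  refine Nat.card_le_mul_card_range_conj _ _ ?_
  have h (g : {g : SpecialLinearGroup (Fin 2) K // (inl g * (inl (unipotent x) * inr τ) :
      WithGal F K) = inl (unipotent x) * inr τ * inl g}) :
      ∃ h : SpecialLinearGroup (Fin 2) F, h 1 0 = 0 ∧ map (algebraMap F K) h = g.1 := by
    obtain ⟨g, hg⟩ := g
    have h1 : Commute (inl g : WithGal F K)
      (inl (unipotent (algebraMap F K (Algebra.trace F K x)))) := by
      rw [← unipotent_mul_inr_pow_card hτ]
      exact Commute.pow_right hg _
    rw [Commute, SemiconjBy, ← map_mul, ← map_mul, inl_inj, mul_unipotent_eq_iff] at h1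
    have h2 : g * unipotent x = unipotent x * galAction F K τ g := by
      simpa using congrArg SemidirectProduct.left hg
    rw [mul_unipotent_eq_iff] at h2
    simp only [galAction_apply] at h2
    have ht : algebraMap F K (Algebra.trace F K x) ≠ 0 := by simpa using hx
    generalize algebraMap F K (Algebra.trace F K x) = t at h1 ht
    have h10 : g 1 0 = 0 := by
      have : t * g 1 0 = 0 := by linear_combination -h1.1
      exact (mul_eq_zero.1 this).resolve_left ht
    have h01 : g 0 0 = g 1 1 := mul_left_cancel₀ ht (by linear_combination h1.2.1)
    rw [h10] at h2
    simp only [map_zero, mul_zero, add_zero, zero_mul, zero_add, true_and] at h2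
    obtain ⟨h, hh⟩ := exists_map_eq_of_galAction_eq hτ (g := g) (by
      ext i j
      fin_cases i <;> fin_cases j
      · exact h2.1.symm
      · show τ (g 0 1) = g 0 1
        linear_combination -h2.2.1 + x * h01 + x * h2.2.2
      · show τ (g 1 0) = g 1 0
        rw [h10, map_zero]
      · exact h2.2.2.symm)
    refine ⟨h, (algebraMap F K).injective ?_, hh⟩
    rw [map_zero, ← h10, ← hh]
    rfl
  choose f hf hf' using h
  exact Nat.card_le_card_of_injective (fun g => ⟨f g, hf g⟩) fun g h hgh =>
    Subtype.ext (by rw [← hf', ← hf', Subtype.mk.inj hgh])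

end Matrix.SpecialLinearGroup

instance SemidirectProduct.finite {N C : Type*} [Group N] [Group C] [Finite N] [Finite C]
    {φ : C →* MulAut N} : Finite (N ⋊[φ] C) :=
  Finite.of_equiv _ SemidirectProduct.equivProd.symm

namespace Matrix.SpecialLinearGroup

open SemidirectProduct

theorem trace_conj_unipotent {R : Type*} [CommRing R] (g : SpecialLinearGroup (Fin 2) R) (x : R) :
    trace ((g * unipotent x * g⁻¹ : SpecialLinearGroup (Fin 2) R) : Matrix (Fin 2) (Fin 2) R)
      = 2 := by
  rw [coe_mul, coe_mul, trace_mul_comm, ← mul_assoc, ← coe_mul, inv_mul_cancel, coe_one, one_mul,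
    coe_unipotent, trace_fin_two_of]
  norm_num

section

variable {F K : Type*} [Field F] [Field K] [Algebra F K] [FiniteDimensional F K] [IsGalois F K]
  {τ : K ≃ₐ[F] K}

theorem exists_pow_card_eq_of_mem_conjugates (hτ : ∀ σ, σ ∈ Subgroup.zpowers τ) {x : K}
    {a : WithGal F K} (ha : a ∈ conjugates (inl (unipotent x) * inr τ : WithGal F K)) :
    ∃ g : SpecialLinearGroup (Fin 2) K, a ^ Nat.card (K ≃ₐ[F] K) =
      inl (g * unipotent (algebraMap F K (Algebra.trace F K x)) * g⁻¹) := by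
  obtain ⟨g, rfl⟩ := ha
  refine ⟨g, ?_⟩
  simp only [conj_pow, unipotent_mul_inr_pow_card hτ, map_mul, map_inv]

/-- A common element would, on raising to the power |Gal|, conjugate one trace unipotent to the
other. -/
theorem disjoint_conjugates (hτ : ∀ σ, σ ∈ Subgroup.zpowers τ) {x y : K}
    (h : ∀ g : SpecialLinearGroup (Fin 2) K,
      g * unipotent (algebraMap F K (Algebra.trace F K x)) ≠
        unipotent (algebraMap F K (Algebra.trace F K y)) * g) :
    Disjoint (conjugates (inl (unipotent x) * inr τ : WithGal F K))
      (conjugates (inl (unipotent y) * inr τ)) := by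
  refine Set.disjoint_left.2 fun a hx hy => ?_
  obtain ⟨g, hg⟩ := exists_pow_card_eq_of_mem_conjugates hτ hx
  obtain ⟨g', hg'⟩ := exists_pow_card_eq_of_mem_conjugates hτ hy
  rw [hg, inl_inj] at hg'
  refine h (g'⁻¹ * g) ?_
  rw [mul_inv_eq_iff_eq_mul] at hg'
  rw [mul_assoc, hg']
  group

theorem disjoint_conjugates_of_trace_eq_zero (hτ : ∀ σ, σ ∈ Subgroup.zpowers τ) {x : K}
    (hx : Algebra.trace F K x ≠ 0) : Disjoint (conjugates (inr τ : WithGal F K))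
      (conjugates (inl (unipotent x) * inr τ)) := by
  have h := disjoint_conjugates hτ (x := 0) (y := x) fun g h => by
    rw [mul_unipotent_eq_iff] at h
    have ht : algebraMap F K (Algebra.trace F K x) ≠ 0 := by simpa using hx
    simp only [map_zero, mul_zero, zero_add] at h
    have h10 : g 1 0 = 0 := by simpa [ht] using h.1
    have h11 : g 1 1 = 0 := by simpa [ht] using h.2.1
    have := g.2
    rw [det_fin_two, h10, h11] at this
    simp at this
  simpa using h

/-- Conjugating `unipotent 1` to `unipotent (-1)` forces `-1` to be the square of a diagonal entry.
-/
theorem disjoint_conjugates_of_trace_eq_one (hτ : ∀ σ, σ ∈ Subgroup.zpowers τ)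
    (hK : ¬ IsSquare (-1 : K)) {x y : K} (hx : Algebra.trace F K x = 1)
    (hy : Algebra.trace F K y = -1) :
    Disjoint (conjugates (inl (unipotent x) * inr τ : WithGal F K))
      (conjugates (inl (unipotent y) * inr τ)) := by
  refine disjoint_conjugates hτ fun g h => hK ⟨g 0 0, ?_⟩
  rw [hx, hy, mul_unipotent_eq_iff] at h
  simp only [map_neg, map_one] at h
  have hd := g.2
  rw [det_fin_two] at hd
  linear_combination hd - g 0 0 * h.2.1 + g 0 1 * h.1

end

theorem pow_card_mul_ringChar_eq_one {F K : Type*} [Field F] [Field K] [Algebra F K]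
    [FiniteDimensional F K] [IsGalois F K] {τ : K ≃ₐ[F] K} (hτ : ∀ σ, σ ∈ Subgroup.zpowers τ)
    (q : ℕ) [CharP K q] {x : K} {a : WithGal F K}
    (ha : a ∈ conjugates (inl (unipotent x) * inr τ : WithGal F K)) :
    a ^ (q * Nat.card (K ≃ₐ[F] K)) = 1 := by
  obtain ⟨g, hg⟩ := exists_pow_card_eq_of_mem_conjugates hτ ha
  rw [mul_comm, pow_mul, hg, ← map_pow, conj_pow, unipotent_pow]
  simp

/-- The classes for traces 0 and 1 have centralizers of order at most 6 and 2, and 1/6 + 1/2 = 2/3.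
-/
theorem card_le_ncard_pow_eq_one_two {K : Type*} [Field K] [Finite K] [Algebra (ZMod 2) K]
    {τ : K ≃ₐ[ZMod 2] K} (hτ : ∀ σ, σ ∈ Subgroup.zpowers τ) :
    2 * Nat.card (SpecialLinearGroup (Fin 2) K) ≤ 3 *
      {a : WithGal (ZMod 2) K | a ^ (2 * Nat.card (K ≃ₐ[ZMod 2] K)) = 1 ∧ a.right = τ}.ncard := by
  obtain ⟨x, hx⟩ := Algebra.trace_surjective (ZMod 2) K 1
  have hx0 : Algebra.trace (ZMod 2) K x ≠ 0 := by rw [hx]; exact one_ne_zero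
  have : CharP K 2 := charP_of_injective_algebraMap (algebraMap (ZMod 2) K).injective 2
  have hsub : conjugates (inr τ : WithGal (ZMod 2) K) ∪ conjugates (inl (unipotent x) * inr τ) ⊆
      {a : WithGal (ZMod 2) K | a ^ (2 * Nat.card (K ≃ₐ[ZMod 2] K)) = 1 ∧ a.right = τ} := by
    rintro a (ha | ha)
    · refine ⟨pow_card_mul_ringChar_eq_one hτ 2 (x := 0) (by simpa using ha), ?_⟩
      simpa using right_eq_of_mem_conjugates ha
    · refine ⟨pow_card_mul_ringChar_eq_one hτ 2 ha, ?_⟩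
      simpa using right_eq_of_mem_conjugates ha
  have h := Set.ncard_le_ncard hsub (Set.toFinite _)
  rw [Set.ncard_union_eq (disjoint_conjugates_of_trace_eq_zero hτ hx0)] at h
  have h1 := card_le_mul_ncard_conjugates_inr hτ
  have h2 := card_le_mul_ncard_conjugates_unipotent hτ hx0
  have c1 : Nat.card (SpecialLinearGroup (Fin 2) (ZMod 2)) = 6 := by
    rw [Nat.card_eq_fintype_card]; decide +kernel
  have c2 : Nat.card {g : SpecialLinearGroup (Fin 2) (ZMod 2) // g 1 0 = 0} = 2 := by
    rw [Nat.card_eq_fintype_card]; decide +kernel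
  rw [c1] at h1
  rw [c2] at h2
  omega

theorem inl_neg_one_mem_center (F K : Type*) [Field F] [Field K] [Algebra F K] :
    (inl (-1) : WithGal F K) ∈ Subgroup.center (WithGal F K) := by
  refine Subgroup.mem_center_iff.2 fun a => ?_
  ext1
  · have : galAction F K a.right (-1) = -1 := by
      ext i j; fin_cases i <;> fin_cases j <;> simp
    simp [this]
  · simp

/-- The classes for traces 0, 1, -1 together with their negatives give 2(1/24 + 1/6 + 1/6) = 3/4. -/
theorem card_le_ncard_pow_mem_three {K : Type*} [Field K] [Finite K] [Algebra (ZMod 3) K]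
    (hK : ¬ IsSquare (-1 : K)) (hodd : Odd (Nat.card (K ≃ₐ[ZMod 3] K)))
    {τ : K ≃ₐ[ZMod 3] K} (hτ : ∀ σ, σ ∈ Subgroup.zpowers τ) :
    3 * Nat.card (SpecialLinearGroup (Fin 2) K) ≤ 4 *
      {a : WithGal (ZMod 3) K | a ^ (3 * Nat.card (K ≃ₐ[ZMod 3] K)) ∈ Subgroup.zpowers (inl (-1)) ∧
        a.right = τ}.ncard := by
  obtain ⟨x, hx⟩ := Algebra.trace_surjective (ZMod 3) K 1
  obtain ⟨y, hy⟩ := Algebra.trace_surjective (ZMod 3) K (-1)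
  have hx0 : Algebra.trace (ZMod 3) K x ≠ 0 := by rw [hx]; decide
  have hy0 : Algebra.trace (ZMod 3) K y ≠ 0 := by rw [hy]; decide
  have : CharP K 3 := charP_of_injective_algebraMap (algebraMap (ZMod 3) K).injective 3
  set A : Set (WithGal (ZMod 3) K) := conjugates (inr τ) ∪ (conjugates (inl (unipotent x) * inr τ) ∪
    conjugates (inl (unipotent y) * inr τ)) with hA
  have hA_mem {a : WithGal (ZMod 3) K} (ha : a ∈ A) :
      ∃ z, a ∈ conjugates (inl (unipotent z) * inr τ) := by
    rcases ha with ha | ha | ha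
    · exact ⟨0, by simpa using ha⟩
    · exact ⟨x, ha⟩
    · exact ⟨y, ha⟩
  have hcomm (a : WithGal (ZMod 3) K) : Commute (inl (-1)) a :=
    (Subgroup.mem_center_iff.1 (inl_neg_one_mem_center _ _) a).symm
  have hAcard : A.ncard = (conjugates (inr τ : WithGal (ZMod 3) K)).ncard +
      ((conjugates (inl (unipotent x) * inr τ : WithGal (ZMod 3) K)).ncard +
        (conjugates (inl (unipotent y) * inr τ : WithGal (ZMod 3) K)).ncard) := by
    rw [Set.ncard_union_eq, Set.ncard_union_eq (disjoint_conjugates_of_trace_eq_one hτ hK hx hy)]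
    exact Set.disjoint_union_right.2 ⟨disjoint_conjugates_of_trace_eq_zero hτ hx0,
      disjoint_conjugates_of_trace_eq_zero hτ hy0⟩
  -- As |Gal| is odd, the sign survives the power, so a common element would give 2 = -2 for matrix
  -- traces.
  have hdisj : Disjoint A ((inl (-1) * ·) '' A) := by
    refine Set.disjoint_left.2 ?_
    rintro _ ha ⟨b, hb, rfl⟩
    obtain ⟨z, hz⟩ := hA_mem ha
    obtain ⟨w, hw⟩ := hA_mem hb
    obtain ⟨g, hg⟩ := exists_pow_card_eq_of_mem_conjugates hτ hz
    obtain ⟨g', hg'⟩ := exists_pow_card_eq_of_mem_conjugates hτ hw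
    rw [(hcomm b).mul_pow, hg', ← map_pow, hodd.neg_one_pow, ← map_mul, inl_inj, neg_one_mul] at hg
    have ht := congrArg (fun g : SpecialLinearGroup (Fin 2) K => trace g.1) hg
    have h1 := trace_conj_unipotent g' (algebraMap (ZMod 3) K (Algebra.trace (ZMod 3) K w))
    have h2 := trace_conj_unipotent g (algebraMap (ZMod 3) K (Algebra.trace (ZMod 3) K z))
    simp only [coe_neg, trace_neg] at ht
    rw [h1, h2] at ht
    have h3 : (3 : K) = 0 := CharP.ofNat_eq_zero K 3
    exact one_ne_zero (α := K) (by linear_combination -h3 - ht)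
  have hsub : A ∪ (inl (-1) * ·) '' A ⊆ {a : WithGal (ZMod 3) K |
      a ^ (3 * Nat.card (K ≃ₐ[ZMod 3] K)) ∈ Subgroup.zpowers (inl (-1)) ∧ a.right = τ} := by
    rintro _ (ha | ⟨a, ha, rfl⟩) <;> obtain ⟨z, hz⟩ := hA_mem ha
    · refine ⟨?_, by simpa using right_eq_of_mem_conjugates hz⟩
      rw [pow_card_mul_ringChar_eq_one hτ 3 hz]
      exact one_mem _
    · refine ⟨?_, by simpa using right_eq_of_mem_conjugates hz⟩
      rw [(hcomm a).mul_pow, pow_card_mul_ringChar_eq_one hτ 3 hz, mul_one]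
      exact Subgroup.npow_mem_zpowers _ _
  have h := Set.ncard_le_ncard hsub (Set.toFinite _)
  rw [Set.ncard_union_eq hdisj, Set.ncard_image_of_injective _ (mul_right_injective _), hAcard] at h
  have h1 := card_le_mul_ncard_conjugates_inr hτ
  have h2 := card_le_mul_ncard_conjugates_unipotent hτ hx0
  have h3 := card_le_mul_ncard_conjugates_unipotent hτ hy0
  have c1 : Nat.card (SpecialLinearGroup (Fin 2) (ZMod 3)) = 24 := by
    rw [Nat.card_eq_fintype_card]; decide +kernel
  have c2 : Nat.card {g : SpecialLinearGroup (Fin 2) (ZMod 3) // g 1 0 = 0} = 6 := by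
    rw [Nat.card_eq_fintype_card]; decide +kernel
  rw [c1] at h1
  rw [c2] at h2 h3
  omega

end Matrix.SpecialLinearGroup

/-! ### Assembling the cosets; multiples of `2 * p` and `3 * p` -/

open SemidirectProduct in
/-- A lower bound for the size of a subset of `N ⋊ C`, given lower bounds on the part lying over
each nontrivial element of `C`. -/
theorem SemidirectProduct.le_mul_ncard_of_forall_fiber {N C : Type*} [Group N] [Group C] [Finite N]
    [Finite C] {φ : C →* MulAut N} {s : Set (N ⋊[φ] C)} (h1 : 1 ∈ s) {c d : ℕ}
    (h : ∀ τ : C, τ ≠ 1 → c * Nat.card N ≤ d * {a | a ∈ s ∧ a.right = τ}.ncard) :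
    (Nat.card C - 1) * (c * Nat.card N) + d ≤ d * s.ncard := by
  classical
  have := Fintype.ofFinite C
  obtain ⟨t, rfl⟩ := s.toFinite.exists_finset_coe
  have hf (τ : C) : {a | a ∈ (t : Set (N ⋊[φ] C)) ∧ a.right = τ} =
      (t.filter fun a => a.right = τ : Finset (N ⋊[φ] C)) := by ext; simp
  simp only [hf, Set.ncard_coe_finset] at h ⊢
  rw [Finset.card_eq_sum_card_fiberwise (f := fun a => a.right) (t := Finset.univ) (by simp),
    ← Finset.add_sum_erase _ _ (Finset.mem_univ 1), mul_add, Finset.mul_sum, add_comm]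
  refine Nat.add_le_add ?_ ?_
  -- The term `d` is the contribution of the identity; without it the case `p = 3` in characteristic
  -- 3 would give only exactly one half.
  · refine Nat.le_mul_of_pos_right _ (Finset.card_pos.2 ⟨1, ?_⟩)
    simpa using h1
  · have := Finset.card_nsmul_le_sum (Finset.univ.erase (1 : C))
      (fun τ => d * (t.filter fun a => a.right = τ).card) (c * Nat.card N)
      fun τ hτ => h τ (Finset.ne_of_mem_erase hτ)
    simpa [Finset.card_erase_of_mem, Nat.card_eq_fintype_card] using this

theorem Matrix.SpecialLinearGroup.not_isSolvable_withGal {F K : Type*} [Field F] [Field K]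
    [Algebra F K] [Finite K] (hK : 3 < Nat.card K) : ¬ Group.IsSolvable (WithGal F K) := by
  intro hs
  classical
  have := Fintype.ofFinite K
  obtain ⟨a, ha⟩ : ∃ a : K, a ∉ ({0, 1, -1} : Finset K) := by
    by_contra! h
    have h1 : (Finset.univ : Finset K) ⊆ {0, 1, -1} := fun a _ => h a
    have := (Finset.card_le_card h1).trans Finset.card_le_three
    rw [Finset.card_univ, ← Nat.card_eq_fintype_card] at this
    omega
  simp only [Finset.mem_insert, Finset.mem_singleton, not_or] at ha
  exact not_isSolvable_fin_two ha.1 (by rw [Ne, sq_eq_one_iff]; tauto)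
    (Group.isSolvable_of_isSolvable_injective (SemidirectProduct.inl_injective
      (φ := galAction F K)))

open Matrix.SpecialLinearGroup

theorem GaloisField.card_algEquiv (q p : ℕ) [Fact q.Prime] (hp : p ≠ 0) :
    Nat.card (GaloisField q p ≃ₐ[ZMod q] GaloisField q p) = p := by
  rw [IsGalois.card_aut_eq_finrank, GaloisField.finrank _ hp]

theorem not_deaconescuConjecture_of_two_mul_prime_dvd {p k : ℕ} (hp : p.Prime) (hp5 : 5 ≤ p)
    (hk : 0 < k) (h : 2 * p ∣ k) : ¬ DeaconescuConjecture k := by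
  have hA := GaloisField.card_algEquiv 2 p hp.ne_zero
  have hpf : Fact p.Prime := ⟨hp⟩
  refine not_deaconescuConjecture_of_card_pow_mem (G := WithGal (ZMod 2) (GaloisField 2 p))
    (not_isSolvable_withGal ?_) ⊥ hk h ?_
  · rw [GaloisField.card _ _ hp.ne_zero]
    exact lt_of_lt_of_le (by norm_num) (Nat.pow_le_pow_right two_pos hp5)
  · have h1 := SemidirectProduct.le_mul_ncard_of_forall_fiber (c := 2) (d := 3)
      (s := {a : WithGal (ZMod 2) (GaloisField 2 p) | a ^ (2 * p) ∈ (⊥ : Subgroup _)}) (by simp)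
      fun τ hτ => by
        have := card_le_ncard_pow_eq_one_two (K := GaloisField 2 p)
          (fun σ => mem_zpowers_of_prime_card hA hτ)
        rw [hA] at this
        simpa using this
    rw [SemidirectProduct.card, hA]
    rw [hA] at h1
    change _ < 2 * {a : WithGal (ZMod 2) (GaloisField 2 p) | a ^ (2 * p) ∈ (⊥ : Subgroup _)}.ncard
    have hN : 0 < Nat.card (Matrix.SpecialLinearGroup (Fin 2) (GaloisField 2 p)) := Nat.card_pos
    generalize Nat.card (Matrix.SpecialLinearGroup (Fin 2) (GaloisField 2 p)) = N at h1 hN ⊢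
    obtain ⟨m, rfl⟩ : ∃ m, p = m + 5 := ⟨p - 5, by omega⟩
    rw [show m + 5 - 1 = m + 4 by omega] at h1
    -- For `p ≥ 5`, (2/3)(p - 1)/p ≥ 8/15 > 1/2.
    nlinarith [Nat.zero_le (m * N)]

theorem not_deaconescuConjecture_of_three_mul_prime_dvd {p k : ℕ} (hp : p.Prime) (hp3 : 3 ≤ p)
    (hk : 0 < k) (h : 3 * p ∣ k) : ¬ DeaconescuConjecture k := by
  have hA := GaloisField.card_algEquiv 3 p hp.ne_zero
  have hpf : Fact p.Prime := ⟨hp⟩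
  have hodd : Odd p := hp.odd_of_ne_two (by omega)
  have hcard := GaloisField.card 3 p hp.ne_zero
  have hsq : ¬ IsSquare (-1 : GaloisField 3 p) := by
    have := Fintype.ofFinite (GaloisField 3 p)
    rw [FiniteField.isSquare_neg_one_iff, ← Nat.card_eq_fintype_card, hcard, not_not]
    obtain ⟨m, rfl⟩ := hodd
    -- An odd power of 3 is 3 modulo 4.
    rw [pow_succ, pow_mul, Nat.mul_mod, Nat.pow_mod]
    norm_num
  have hZ := Subgroup.normal_zpowers_of_mem_center
    (inl_neg_one_mem_center (ZMod 3) (GaloisField 3 p))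
  refine not_deaconescuConjecture_of_card_pow_mem (G := WithGal (ZMod 3) (GaloisField 3 p))
    (not_isSolvable_withGal ?_) (Subgroup.zpowers (SemidirectProduct.inl (-1))) hk h ?_
  · rw [hcard]
    exact lt_of_lt_of_le (by norm_num) (Nat.pow_le_pow_right three_pos hp3)
  · have h1 := SemidirectProduct.le_mul_ncard_of_forall_fiber (c := 3) (d := 4)
      (s := {a : WithGal (ZMod 3) (GaloisField 3 p) |
        a ^ (3 * p) ∈ Subgroup.zpowers (SemidirectProduct.inl (-1))})
      (by rw [Set.mem_ofPred_eq, one_pow]; exact one_mem _)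
      fun τ hτ => by
        have := card_le_ncard_pow_mem_three (K := GaloisField 3 p) hsq (by rwa [hA])
          (fun σ => mem_zpowers_of_prime_card hA hτ)
        rwa [hA] at this
    rw [SemidirectProduct.card, hA]
    rw [hA] at h1
    change _ < 2 * {a : WithGal (ZMod 3) (GaloisField 3 p) |
      a ^ (3 * p) ∈ Subgroup.zpowers (SemidirectProduct.inl (-1))}.ncard
    generalize Nat.card (Matrix.SpecialLinearGroup (Fin 2) (GaloisField 3 p)) = N at h1 ⊢
    obtain ⟨m, rfl⟩ : ∃ m, p = m + 3 := ⟨p - 3, by omega⟩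
    rw [show m + 3 - 1 = m + 2 by omega] at h1
    nlinarith [Nat.zero_le (m * N)]

theorem theorem1p2 :
    (∀ k : ℕ, 4 < k → (2 ∣ k ∨ 3 ∣ k) → ¬ DeaconescuConjecture k) ∧
    (∃ k : ℕ, ¬ 2 ∣ k ∧ ¬ 3 ∣ k ∧ ¬ DeaconescuConjecture k) := by
  refine ⟨fun k hk h => ?_, 55, by norm_num, by norm_num, not_deaconescuConjecture_fiftyFive⟩
  have hk0 : 0 < k := by omega
  rcases h with ⟨m, rfl⟩ | ⟨m, rfl⟩
  · rcases Nat.eq_two_pow_or_exists_odd_prime_and_dvd m with ⟨n, rfl⟩ | ⟨p, hp, hpm, hodd⟩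
    -- This is where `k > 4` enters: a power of 2 above 4 is divisible by 8.
    · have hn : 2 ≤ n := by
        by_contra! hn
        interval_cases n <;> omega
      exact not_deaconescuConjecture_of_eight_dvd hk0
        (Nat.mul_dvd_mul_left 2 (pow_dvd_pow 2 hn : 2 ^ 2 ∣ 2 ^ n))
    · have h2 := hp.two_le
      rcases lt_or_ge p 5 with h5 | h5
      · obtain rfl : p = 3 := by interval_cases p <;> revert hodd hp <;> decide
        exact not_deaconescuConjecture_of_six_dvd hk0 (Nat.mul_dvd_mul_left 2 hpm)
      · exact not_deaconescuConjecture_of_two_mul_prime_dvd hp h5 hk0 (Nat.mul_dvd_mul_left 2 hpm)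
  · obtain ⟨p, hp, hpm⟩ := Nat.exists_prime_and_dvd (n := m) (by omega)
    rcases lt_or_ge p 3 with h3 | h3
    · obtain rfl : p = 2 := le_antisymm (by omega) hp.two_le
      exact not_deaconescuConjecture_of_six_dvd hk0 (Nat.mul_dvd_mul_left 3 hpm)
    · exact not_deaconescuConjecture_of_three_mul_prime_dvd hp h3 hk0 (Nat.mul_dvd_mul_left 3 hpm)
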